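/- Let $L$ be a finite lattice and $k$ a field. A (finite dimensional) representation $M$ of $L$ over $k$ consists of finite dimensional $k$-vector spaces $M_x$ ($x\in L$) and linear maps $M_x\to M_y$ ($x\le y$), functorial in $x\le y$; these form the category $\operatorname{mod} kL$ of finite dimensional modules over the incidence algebra $kL$. Let $D^b(kL)$ be its bounded derived category. A Serre functor on $D^b(kL)$ is an autoequivalence $\mathbb S$ together with $k$-linear isomorphisms $\operatorname{Hom}(X,Y)\cong\operatorname{Hom}(Y,\mathbb S X)^*$, natural in $X$ and $Y$. Let $\alpha\in L$ and let $C\subseteq L$ be a (possibly empty) antichain over $\alpha$, i.e. the elements of $C$ are pairwise incomparable and $\alpha<c$ for all $c\in C$. For $A\subseteq C$ put $\gamma^C_\alpha(A)=\bigvee A$ if $A\ne\emptyset$ and $\gamma^C_\alpha(\emptyset)=\alpha$. Assume that $C$ is boolean over $\alpha$, i.e. $\gamma^C_\alpha$ is an embedding of lattices (injective, preserving joins and meets) from the lattice of subsets of $C$, ordered by inclusion, to $L$. Put $$\beta=\gamma^C_\alpha(C),\qquad D=\{\gamma^C_\alpha(C')\mid C'\subseteq C,\ |C'|=|C|-1\}$$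 (so that $\beta=\alpha$ and $D=\emptyset$ if $C=\emptyset$, and $D=\{\alpha\}$ if $|C|=1$). Let $M^C_\alpha$ be the representation that is $k$ on $\{y\in L\mid \alpha\le y,\ c\nleq y\ \forall c\in C\}$ and $0$ elsewhere, and let $M^\beta_D$ be the representation that is $k$ on $\{y\in L\mid y\le\beta,\ y\nleq d\ \forall d\in D\}$ and $0$ elsewhere; in both cases the structure maps are $\mathrm{id}_k$ wherever possible and $0$ else. Regard both as complexes concentrated in degree $0$. Then: 1. $D$ is a dual boolean antichain under $\beta$: its elements are pairwise incomparable and strictly below $\beta$, and the map $\emptyset\mapsto\beta$, $A\mapsto\bigwedge A$ for $A\neq\emptyset$, is an embedding of lattices from the lattice of subsets of $D$, ordered by reverse inclusion, to $L$. 2. $M^\beta_D[|C|]$ is Serre dual to $M^C_\alpha$ in $D^b(kL)$: there are $k$-linear isomorphisms $\operatorname{Hom}(M^C_\alpha,Y)\cong\operatorname{Hom}(Y,M^\beta_D[|C|])^*$, natural in $Y\in D^b(kL)$. 3. For every Serre functor $\mathbb S$ on $D^b(kL)$ one has $\mathbb S M^C_\alpha\cong M^\beta_D[|C|]$ in $D^b(kL)$.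 -/

import Mathlib

open CategoryTheory

universe w v u

namespace AntichainSerre

section Lattice

variable {L : Type u} [Lattice L]

/-- The map `γ` of join semilattices attached to `α`: a nonempty finite set goes to its join, and
the empty set goes to `α`. -/
def joinOver (α : L) (A : Finset L) : L :=
  if h : A.Nonempty then A.sup' h id else α

/-- The map of meet semilattices attached to `β`: a nonempty finite set goes to its meet, and
the empty set goes to `β`. -/
def meetUnder (β : L) (A : Finset L) : L :=
  if h : A.Nonempty then A.inf' h id else β

/-- `C` is an antichain over `α`: its elements are pairwise incomparable and `α` is a strict lower
bound of each of them. -/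
structure IsAntichainOver (C : Finset L) (α : L) : Prop where
  antichain : IsAntichain (· ≤ ·) (C : Set L)
  lt : ∀ c ∈ C, α < c

/-- `D` is an antichain under `β`: its elements are pairwise incomparable and `β` is a strict upper
bound of each of them. -/
structure IsAntichainUnder (D : Finset L) (β : L) : Prop where
  antichain : IsAntichain (· ≤ ·) (D : Set L)
  lt : ∀ d ∈ D, d < β

/-- `C` is a boolean antichain over `α`: the map `joinOver α` is an embedding of lattices (an
injective map preserving joins and meets) from the lattice of subsets of `C`, ordered by inclusion,
to `L`. -/
structure IsBoolean [DecidableEq L] (C : Finset L) (α : L) : Prop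
    extends IsAntichainOver C α where
  injOn : ∀ A ⊆ C, ∀ B ⊆ C, joinOver α A = joinOver α B → A = B
  map_sup : ∀ A ⊆ C, ∀ B ⊆ C, joinOver α (A ∪ B) = joinOver α A ⊔ joinOver α B
  map_inf : ∀ A ⊆ C, ∀ B ⊆ C, joinOver α (A ∩ B) = joinOver α A ⊓ joinOver α B

/-- `D` is a dual boolean antichain under `β`: the map `meetUnder β` is an embedding of lattices
from the lattice of subsets of `D`, ordered by reverse inclusion, to `L`. -/
structure IsDualBoolean [DecidableEq L] (D : Finset L) (β : L) : Prop
    extends IsAntichainUnder D β where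
  injOn : ∀ A ⊆ D, ∀ B ⊆ D, meetUnder β A = meetUnder β B → A = B
  map_inf : ∀ A ⊆ D, ∀ B ⊆ D, meetUnder β (A ∪ B) = meetUnder β A ⊓ meetUnder β B
  map_sup : ∀ A ⊆ D, ∀ B ⊆ D, meetUnder β (A ∩ B) = meetUnder β A ⊔ meetUnder β B

/-- The top `β` of the boolean lattice generated by `C` over `α`: the join of `C`
(and `α` if `C` is empty). -/
def topOf (C : Finset L) (α : L) : L := joinOver α C

/-- The set of the joins of all subsets of `C` with `|C| - 1` elements. If `C` is empty there is
no such subset; the join of the empty set is `α`. -/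
def coatomsOf [DecidableEq L] (C : Finset L) (α : L) : Finset L :=
  (C.powerset.filter fun A => A.card + 1 = C.card).image (joinOver α)

/-- The support of the antichain module of `C` over `α`. -/
def antichainSupport (C : Finset L) (α : L) : Set L :=
  {y | α ≤ y ∧ ∀ c ∈ C, ¬ c ≤ y}

/-- The support of the dual antichain module of `D` under `β`. -/
def dualAntichainSupport (D : Finset L) (β : L) : Set L :=
  {y | y ≤ β ∧ ∀ d ∈ D, ¬ y ≤ d}

theorem antichainSupport_ordConnected (C : Finset L) (α : L) :
    (antichainSupport C α).OrdConnected :=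
  ⟨fun _ hx _ hz _ hy => ⟨hx.1.trans hy.1, fun c hc h => hz.2 c hc (h.trans hy.2)⟩⟩

theorem dualAntichainSupport_ordConnected (D : Finset L) (β : L) :
    (dualAntichainSupport D β).OrdConnected :=
  ⟨fun _ hx _ hz _ hy => ⟨hy.2.trans hz.1, fun d hd h => hx.2 d hd (hy.1.trans h)⟩⟩

end Lattice

section Representations

variable (k : Type v) [Field k] (L : Type u) [Lattice L]

/-- The category of finite dimensional representations of `L` over `k` (for finite `L`, this is the
category of finite dimensional modules over the incidence algebra `kL`). -/
abbrev LatticeRep := L ⥤ FGModuleCat.{v} k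

end Representations

section ConvexSupport

variable (k : Type v) [Field k]

open Classical in
/-- The value at `x` of the representation with support `S`: it is `k` if `x ∈ S`, and `0`
otherwise. -/
noncomputable def suppValue {L : Type u} (S : Set L) (x : L) : Submodule k k := if x ∈ S then ⊤ else ⊥

theorem mem_suppValue {L : Type u} {S : Set L} {x : L} {a : k} : a ∈ suppValue k S x ↔ (x ∉ S → a = 0) := by
  unfold suppValue
  split_ifs with h <;> simp [h]

open Classical in
/-- The structure map from the value at `x` to the value at `y`: the identity of `k` if `x` and `y`
both lie in `S`, and `0` otherwise. -/
noncomputable def suppMap {L : Type u} (S : Set L) (x y : L) : suppValue k S x →ₗ[k] suppValue k S y :=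
  ((if x ∈ S ∧ y ∈ S then LinearMap.id else 0 : k →ₗ[k] k).comp
    (suppValue k S x).subtype).codRestrict (suppValue k S y) (by
      intro a
      rw [mem_suppValue]
      intro hy
      simp [hy])

theorem suppMap_apply_coe {L : Type u} (S : Set L) (x y : L) (hy : y ∈ S) (a : suppValue k S x) :
    (suppMap k S x y a : k) = a := by
  by_cases hx : x ∈ S
  · simp [suppMap, hx, hy]
  · have : (a : k) = 0 := (mem_suppValue k).1 a.2 hx
    simp [suppMap, hx, this]

variable {L : Type u} [Lattice L]

/-- The representation of `L` that is `k` on a convex subset `S` and `0` elsewhere, with structure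
maps the identity of `k` wherever possible and `0` else. -/
noncomputable def convexRep (S : Set L) (hS : S.OrdConnected) : LatticeRep k L where
  obj x := FGModuleCat.of k (suppValue k S x)
  map {x y} _ := FGModuleCat.ofHom (suppMap k S x y)
  map_id x := by
    ext a
    by_cases hx : x ∈ S
    · exact suppMap_apply_coe k S x x hx a
    · exact ((mem_suppValue k).1 (suppMap k S x x a).2 hx).trans ((mem_suppValue k).1 a.2 hx).symm
  map_comp {x y z} f g := by
    ext a
    change (suppMap k S x z a : k) = (suppMap k S y z (suppMap k S x y a) : k)
    by_cases hz : z ∈ S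
    · rw [suppMap_apply_coe k S x z hz, suppMap_apply_coe k S y z hz]
      by_cases hy : y ∈ S
      · rw [suppMap_apply_coe k S x y hy]
      · have hx : x ∉ S := fun hx => hy (hS.out hx hz ⟨leOfHom f, leOfHom g⟩)
        rw [(mem_suppValue k).1 a.2 hx, (mem_suppValue k).1 (suppMap k S x y a).2 hy]
    · rw [(mem_suppValue k).1 (suppMap k S x z a).2 hz,
        (mem_suppValue k).1 (suppMap k S y z (suppMap k S x y a)).2 hz]

/-- The antichain module of `C` over `α`. -/
noncomputable def antichainModule (C : Finset L) (α : L) : LatticeRep k L :=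
  convexRep k (antichainSupport C α) (antichainSupport_ordConnected C α)

/-- The dual antichain module of `D` under `β`. -/
noncomputable def dualAntichainModule (D : Finset L) (β : L) : LatticeRep k L :=
  convexRep k (dualAntichainSupport D β) (dualAntichainSupport_ordConnected D β)

end ConvexSupport

section Serre

/-- A Serre functor on a `k`-linear category: an autoequivalence `S` together with `k`-linear
isomorphisms `Hom(X, Y) ≅ Hom(Y, S X)*`, natural in `X` and in `Y`. (Such isomorphisms exist only
if the category is Hom-finite.) -/
structure SerreFunctor (k : Type v) [Field k] (𝒟 : Type*) [Category* 𝒟] [Preadditive 𝒟]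
    [Linear k 𝒟] where
  functor : 𝒟 ⥤ 𝒟
  isEquivalence : functor.IsEquivalence
  duality (X Y : 𝒟) : (X ⟶ Y) ≃ₗ[k] Module.Dual k (Y ⟶ functor.obj X)
  naturality_right {X Y Z : 𝒟} (f : X ⟶ Y) (h : Y ⟶ Z) (g : Z ⟶ functor.obj X) :
    duality X Z (f ≫ h) g = duality X Y f (h ≫ g)
  naturality_left {X' X Y : 𝒟} (a : X' ⟶ X) (f : X ⟶ Y) (g : Y ⟶ functor.obj X') :
    duality X' Y (a ≫ f) g = duality X Y f (g ≫ functor.map a)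

/-- `X'` is Serre dual to `X`: there are `k`-linear isomorphisms `Hom(X, Y) ≅ Hom(Y, X')*`,
natural in `Y`. -/
def IsSerreDual (k : Type v) [Field k] {𝒟 : Type*} [Category* 𝒟] [Preadditive 𝒟]
    [Linear k 𝒟] (X X' : 𝒟) : Prop :=
  ∃ φ : ∀ Y : 𝒟, (X ⟶ Y) ≃ₗ[k] Module.Dual k (Y ⟶ X'),
    ∀ (Y Z : 𝒟) (f : X ⟶ Y) (h : Y ⟶ Z) (g : Z ⟶ X'), φ Z (f ≫ h) g = φ Y f (h ≫ g)

end Serre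

section Derived

variable {A : Type*} [Category* A] [Abelian A] [HasDerivedCategory.{w} A]

/-- An object of an abelian category, as a complex concentrated in degree `0` in the bounded derived
category. -/
noncomputable def stalk (M : A) : DerivedCategory.Bounded A :=
  ⟨(DerivedCategory.singleFunctor A 0).obj M,
    ⟨⟨0, inferInstance⟩,
     ⟨0, inferInstance⟩⟩⟩

end Derived

end AntichainSerre

open AntichainSerre

/-! Serre duality exchanges the projective `k` on `{y | x ≤ y}` with the injective `k` on `{y | y ≤
x}`, and the two modules are assembled from these in parallel by taking cones. For `B ⊆ U ⊆ C`, the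
representation on `upperCell α (U \ B) B` is shown to be dual to that on `lowerCell α U B`, shifted
by `|B|`, by induction on `B` (`serreDualPair_cells`). If `B` is empty, the cells are the principal
filter and ideal of the join of `U`. Adding `b` to `B` makes the upper cell a cokernel and the lower
cell a kernel, both of maps between smaller cells; passing from kernel to cone costs one shift. The
case `U = B = C` is the claim.

Cones are not functorial, so duality is recorded by a linear form on `Hom(X, X')`, which by the
Yoneda lemma carries the same data as a natural isomorphism. Compatible forms on two vertices of a
pair of triangles extend to the third (`exists_form_cone`), and the five lemma keeps the pairing
perfect (`IsSerreForm.cone`). Compatibility is arranged by rescaling: the adjoint of the nonzero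
inclusion of upper cells is a nonzero multiple of the canonical map of lower cells, since every
morphism between the latter is such a multiple (`SerreDualPair.cone`).

Part 1 is complementation: the meet of the coatoms omitting the elements of `B` is the join of `C \
B`. Part 3 is uniqueness of representing objects. -/

namespace AntichainSerre

/-! ### Linear algebra: duals of exact sequences and gluing of linear forms. -/

section LinearAlgebra

variable {k : Type*} [Field k]

theorem exact_dualMap {V₁ V₂ V₃ : Type*} [AddCommGroup V₁] [AddCommGroup V₂] [AddCommGroup V₃]
    [Module k V₁] [Module k V₂] [Module k V₃] {f : V₁ →ₗ[k] V₂} {g : V₂ →ₗ[k] V₃}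
    (h : Function.Exact f g) : Function.Exact g.dualMap f.dualMap := by
  rw [LinearMap.exact_iff] at h ⊢
  rw [LinearMap.ker_dualMap_eq_dualAnnihilator_range,
    LinearMap.range_dualMap_eq_dualAnnihilator_ker, h]

/-- The compatibility condition says that `(a, b)` kills the kernel of `(i, j) : U × V → W`, so it
descends to the range of `(i, j)` and extends from there to `W`. -/
theorem exists_linear_extension {U V W : Type*} [AddCommGroup U] [AddCommGroup V] [AddCommGroup W]
    [Module k U] [Module k V] [Module k W] (i : U →ₗ[k] W) (j : V →ₗ[k] W) (a : U →ₗ[k] k)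
    (b : V →ₗ[k] k) (h : ∀ u v, i u = j v → a u = b v) :
    ∃ t : W →ₗ[k] k, (∀ u, t (i u) = a u) ∧ ∀ v, t (j v) = b v := by
  have hk : LinearMap.ker (i.coprod j) ≤ LinearMap.ker (a.coprod b) := by
    rintro ⟨u, v⟩ huv
    simp only [LinearMap.mem_ker, LinearMap.coprod_apply] at huv ⊢
    have := h u (-v) (by rw [map_neg]; exact eq_neg_of_add_eq_zero_left huv)
    rw [this, map_neg, neg_add_cancel]
  obtain ⟨t, ht⟩ := LinearMap.exists_extend
    (((LinearMap.ker (i.coprod j)).liftQ (a.coprod b) hk).comp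
      (i.coprod j).quotKerEquivRange.symm.toLinearMap)
  have key : ∀ x, t (i.coprod j x) = a.coprod b x := fun x => by
    have := LinearMap.congr_fun ht ⟨i.coprod j x, LinearMap.mem_range_self _ x⟩
    simp only [LinearMap.comp_apply, Submodule.subtype_apply] at this
    rw [this]
    have e : (i.coprod j).quotKerEquivRange.symm ⟨i.coprod j x, LinearMap.mem_range_self _ x⟩ =
        (LinearMap.ker (i.coprod j)).mkQ x := by
      rw [LinearEquiv.symm_apply_eq]
      rfl
    change ((LinearMap.ker (i.coprod j)).liftQ (a.coprod b) hk) _ = _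
    erw [e]
    rfl
  exact ⟨t, fun u => by simpa using key (u, 0), fun v => by simpa using key (0, v)⟩

end LinearAlgebra

/-! ### Serre duality expressed by linear forms. -/

section Pairing

variable {k : Type*} [Field k] {𝒟 : Type*} [Category* 𝒟] [Preadditive 𝒟] [Linear k 𝒟]

/-- The pairing of `Hom(X, Z)` with `Hom(Z, X')` induced by a linear form on `Hom(X, X')`. -/
def serrePairing {X X' : 𝒟} (t : (X ⟶ X') →ₗ[k] k) (Z : 𝒟) :
    (X ⟶ Z) →ₗ[k] Module.Dual k (Z ⟶ X') :=
  (Linear.comp X Z X').compr₂ t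

@[simp]
theorem serrePairing_apply {X X' : 𝒟} (t : (X ⟶ X') →ₗ[k] k) (Z : 𝒟) (f : X ⟶ Z) (g : Z ⟶ X') :
    serrePairing t Z f g = t (f ≫ g) := rfl

/-- The linear form `t` on `Hom(X, X')` induces a perfect pairing of the finite dimensional spaces
`Hom(X, Z)` and `Hom(Z, X')`. -/
structure IsSerreForm {X X' : 𝒟} (t : (X ⟶ X') →ₗ[k] k) (Z : 𝒟) : Prop where
  finite : Module.Finite k (Z ⟶ X')
  bijective : Function.Bijective (serrePairing t Z)

variable (k) in
/-- Some linear form on `Hom(X, X')` induces perfect pairings of finite dimensional spaces for all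
`Z` in `P`. -/
def SerreDualPair (P : ObjectProperty 𝒟) (X X' : 𝒟) : Prop :=
  ∃ t : (X ⟶ X') →ₗ[k] k, ∀ Z, P Z → IsSerreForm t Z

namespace IsSerreForm

/-- Finite dimensionality makes the pairing perfect on the other side too: `X'` represents the dual
of `Hom(X, -)`. This produces adjoints of morphisms. -/
theorem exists_comp_eq {X X' Z : 𝒟} {t : (X ⟶ X') →ₗ[k] k} (h : IsSerreForm t Z)
    (s : (X ⟶ Z) →ₗ[k] k) : ∃ g : Z ⟶ X', ∀ f : X ⟶ Z, t (f ≫ g) = s f := by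
  have := h.finite
  have := LinearMap.IsPerfPair.of_bijective _ h.bijective
  obtain ⟨g, hg⟩ := (LinearMap.IsPerfPair.bijective_right (serrePairing t Z)).2 s
  exact ⟨g, fun f => LinearMap.congr_fun hg f⟩

theorem ext_right {X X' Z : 𝒟} {t : (X ⟶ X') →ₗ[k] k} (h : IsSerreForm t Z) {g g' : Z ⟶ X'}
    (hg : ∀ f : X ⟶ Z, t (f ≫ g) = t (f ≫ g')) : g = g' := by
  have := h.finite
  have := LinearMap.IsPerfPair.of_bijective _ h.bijective
  exact (LinearMap.IsPerfPair.bijective_right (serrePairing t Z)).1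
    (LinearMap.ext fun f => hg f)

theorem ext_left {X X' Z : 𝒟} {t : (X ⟶ X') →ₗ[k] k} (h : IsSerreForm t Z) {f f' : X ⟶ Z}
    (hf : ∀ g : Z ⟶ X', t (f ≫ g) = t (f' ≫ g)) : f = f' :=
  h.bijective.1 (LinearMap.ext fun g => hf g)

/-- Transport of a form along linear equivalences compatible with composition. -/
theorem congr {ℰ : Type*} [Category* ℰ] [Preadditive ℰ] [Linear k ℰ] {X X' Z : 𝒟} {W W' T : ℰ}
    {t : (X ⟶ X') →ₗ[k] k} {s : (W ⟶ W') →ₗ[k] k} (h : IsSerreForm t Z)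
    (e₁ : (X ⟶ Z) ≃ₗ[k] (W ⟶ T)) (e₂ : (Z ⟶ X') ≃ₗ[k] (T ⟶ W'))
    (he : ∀ f g, s (e₁ f ≫ e₂ g) = t (f ≫ g)) : IsSerreForm s T := by
  refine ⟨have := h.finite; Module.Finite.equiv e₂, ?_⟩
  have : (serrePairing s T) =
      (e₂.symm.dualMap.toLinearMap ∘ₗ serrePairing t Z ∘ₗ e₁.symm.toLinearMap) := by
    ext f g
    simp [← he]
  rw [this]
  exact e₂.symm.dualMap.bijective.comp (h.bijective.comp e₁.symm.bijective)

theorem of_iso {X X' Z Z' : 𝒟} {t : (X ⟶ X') →ₗ[k] k} (h : IsSerreForm t Z) (e : Z ≅ Z') :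
    IsSerreForm t Z' :=
  h.congr (Linear.homCongr k (Iso.refl X) e) (Linear.homCongr k e (Iso.refl X'))
    (by simp [Linear.homCongr_apply])

theorem smul {X X' Z : 𝒟} {t : (X ⟶ X') →ₗ[k] k} (h : IsSerreForm t Z) {c : k} (hc : c ≠ 0) :
    IsSerreForm (c • t) Z :=
  h.congr (LinearEquiv.smulOfNeZero k (X ⟶ Z) c⁻¹ (inv_ne_zero hc)) (LinearEquiv.refl k _)
    (by simp [hc])

end IsSerreForm

namespace SerreDualPair

variable {P : ObjectProperty 𝒟}

theorem of_iso {X X' W W' : 𝒟} (h : SerreDualPair k P X X') (e : X ≅ W) (e' : X' ≅ W') :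
    SerreDualPair k P W W' := by
  obtain ⟨t, ht⟩ := h
  refine ⟨t ∘ₗ (Linear.homCongr k e e').symm.toLinearMap, fun Z hZ => (ht Z hZ).congr
    (Linear.homCongr k e (Iso.refl Z)) (Linear.homCongr k (Iso.refl Z) e') ?_⟩
  simp [Linear.homCongr_apply, Linear.homCongr_symm_apply]

/-- Serre dual pairs in a full subcategory. -/
theorem fullSubcategory {X X' : P.FullSubcategory} (h : SerreDualPair k P X.obj X'.obj) :
    SerreDualPair k ⊤ X X' := by
  obtain ⟨t, ht⟩ := h
  let e (U V : P.FullSubcategory) : (U ⟶ V) ≃ₗ[k] (U.obj ⟶ V.obj) :=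
    { toFun := fun f => f.hom
      invFun := fun f => ⟨f⟩
      map_add' := fun _ _ => rfl
      map_smul' := fun _ _ => rfl
      left_inv := fun _ => rfl
      right_inv := fun _ => rfl }
  exact ⟨t ∘ₗ (e X X').toLinearMap, fun Z _ => (ht Z.obj Z.property).congr (e X Z).symm
    (e Z X').symm fun _ _ => rfl⟩

theorem isSerreDual {k : Type v} [Field k] [Linear k 𝒟] {X X' : 𝒟}
    (h : SerreDualPair k (⊤ : ObjectProperty 𝒟) X X') : IsSerreDual k X X' := by
  obtain ⟨t, ht⟩ := h
  refine ⟨fun Y => LinearEquiv.ofBijective _ (ht Y trivial).bijective, fun Y Z f h g => ?_⟩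
  simp

theorem nonempty_iso {X X' X'' : 𝒟} (h : SerreDualPair k (⊤ : ObjectProperty 𝒟) X X')
    (h' : SerreDualPair k (⊤ : ObjectProperty 𝒟) X X'') : Nonempty (X' ≅ X'') := by
  obtain ⟨t, ht⟩ := h
  obtain ⟨s, hs⟩ := h'
  obtain ⟨a, ha⟩ := (hs X' trivial).exists_comp_eq t
  obtain ⟨b, hb⟩ := (ht X'' trivial).exists_comp_eq s
  refine ⟨⟨a, b, (ht X' trivial).ext_right fun f => ?_, (hs X'' trivial).ext_right fun f => ?_⟩⟩
  · rw [← Category.assoc, hb, ha, Category.comp_id]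
  · rw [← Category.assoc, ha, hb, Category.comp_id]

/-- The form of a Serre functor is the image of `𝟙 X` under the duality. Finiteness of `Hom(Z, S X)`
is inherited from the given pair, since its dual is isomorphic to `Hom(X, Z)`. -/
theorem serreFunctor_iso {k : Type v} [Field k] [Linear k 𝒟] {X X' : 𝒟}
    (h : SerreDualPair k (⊤ : ObjectProperty 𝒟) X X') (S : SerreFunctor k 𝒟) :
    Nonempty (S.functor.obj X ≅ X') := by
  refine nonempty_iso (k := k) (X := X) ?_ h
  obtain ⟨t, ht⟩ := h
  refine ⟨S.duality X X (𝟙 X), fun Z _ => ⟨?_, ?_⟩⟩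
  · have := (ht Z trivial).finite
    have : Module.Finite k (Module.Dual k (Z ⟶ S.functor.obj X)) :=
      Module.Finite.equiv
        ((LinearEquiv.ofBijective _ (ht Z trivial).bijective).symm.trans (S.duality X Z))
    exact Module.finite_dual_iff k |>.1 this
  · have key : serrePairing (S.duality X X (𝟙 X)) Z = (S.duality X Z).toLinearMap := by
      ext f g
      have := S.naturality_right (𝟙 X) f g
      rw [Category.id_comp] at this
      exact this.symm
    rw [key]
    exact (S.duality X Z).bijective

end SerreDualPair

end Pairing

/-! ### Shifting forms. -/

section Shift

variable {k : Type*} [Field k] {𝒟 : Type*} [Category* 𝒟] [Preadditive 𝒟] [Linear k 𝒟]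
  [HasShift 𝒟 ℤ] [∀ n : ℤ, (shiftFunctor 𝒟 n).Additive]
  [∀ n : ℤ, (shiftFunctor 𝒟 n).Linear k]

variable (k) in
/-- The shift functor on morphisms, as a linear equivalence. -/
noncomputable def shiftHomEquiv (n : ℤ) (X Y : 𝒟) : (X ⟶ Y) ≃ₗ[k] (X⟦n⟧ ⟶ Y⟦n⟧) :=
  LinearEquiv.ofBijective ((shiftFunctor 𝒟 n).mapLinearMap k)
    ⟨(shiftFunctor 𝒟 n).map_injective, (shiftFunctor 𝒟 n).map_surjective⟩

@[simp]
theorem shiftHomEquiv_apply (n : ℤ) {X Y : 𝒟} (f : X ⟶ Y) : shiftHomEquiv k n X Y f = f⟦n⟧' := rfl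

/-- The linear form on `Hom(X⟦n⟧, X'⟦n⟧)` induced by a linear form on `Hom(X, X')`. -/
noncomputable def shiftForm (n : ℤ) {X X' : 𝒟} (t : (X ⟶ X') →ₗ[k] k) :
    (X⟦n⟧ ⟶ X'⟦n⟧) →ₗ[k] k :=
  t ∘ₗ (shiftHomEquiv k n X X').symm.toLinearMap

@[simp]
theorem shiftForm_map (n : ℤ) {X X' : 𝒟} (t : (X ⟶ X') →ₗ[k] k) (f : X ⟶ X') :
    shiftForm n t (f⟦n⟧') = t f := by
  rw [← shiftHomEquiv_apply (k := k), shiftForm, LinearMap.comp_apply, LinearEquiv.coe_coe,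
    LinearEquiv.symm_apply_apply]

theorem IsSerreForm.shift {X X' Z : 𝒟} {t : (X ⟶ X') →ₗ[k] k} (h : IsSerreForm t Z) (n : ℤ) :
    IsSerreForm (shiftForm n t) (Z⟦n⟧) :=
  h.congr (shiftHomEquiv k n X Z) (shiftHomEquiv k n Z X') fun f g => by
    rw [shiftHomEquiv_apply, shiftHomEquiv_apply, ← Functor.map_comp, shiftForm_map]

theorem isSerreForm_shift {P : ObjectProperty 𝒟} [P.IsStableUnderShift ℤ]
    {X X' : 𝒟} {t : (X ⟶ X') →ₗ[k] k} (h : ∀ Z, P Z → IsSerreForm t Z) (n : ℤ) (Z : 𝒟)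
    (hZ : P Z) : IsSerreForm (shiftForm n t) Z :=
  ((h _ (P.le_shift (-n) _ hZ)).shift n).of_iso (shiftNegShift Z n)

theorem SerreDualPair.shift {P : ObjectProperty 𝒟} [P.IsStableUnderShift ℤ] {X X' : 𝒟}
    (h : SerreDualPair k P X X') (n : ℤ) : SerreDualPair k P (X⟦n⟧) (X'⟦n⟧) := by
  obtain ⟨t, ht⟩ := h
  exact ⟨shiftForm n t, isSerreForm_shift ht n⟩

end Shift

/-! ### Forms and distinguished triangles. -/

section Triangulated

open Pretriangulated Limits

theorem finite_of_exact {k : Type*} [Field k] {V₁ V₂ V₃ : Type*} [AddCommGroup V₁]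
    [AddCommGroup V₂] [AddCommGroup V₃] [Module k V₁] [Module k V₂] [Module k V₃]
    {f : V₁ →ₗ[k] V₂} {g : V₂ →ₗ[k] V₃} (h : Function.Exact f g) [Module.Finite k V₁]
    [Module.Finite k V₃] : Module.Finite k V₂ := by
  have : Module.Finite k (LinearMap.ker g) := by
    rw [LinearMap.exact_iff.1 h]
    infer_instance
  have : Module.Finite k (V₂ ⧸ LinearMap.ker g) :=
    Module.Finite.equiv g.quotKerEquivRange.symm
  exact Module.Finite.of_submodule_quotient (LinearMap.ker g)

variable {k : Type*} [Field k] {𝒟 : Type*} [Category* 𝒟] [Preadditive 𝒟] [Linear k 𝒟]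
  [HasZeroObject 𝒟] [HasShift 𝒟 ℤ] [∀ n : ℤ, (shiftFunctor 𝒟 n).Additive] [Pretriangulated 𝒟]

variable (k) in
theorem rightComp_exact {T : Triangle 𝒟} (hT : T ∈ distTriang 𝒟) (W : 𝒟) :
    Function.Exact (Linear.rightComp k W T.mor₁) (Linear.rightComp k W T.mor₂) := by
  intro f
  constructor
  · intro hf
    obtain ⟨g, hg⟩ := Triangle.coyoneda_exact₂ T hT f hf
    exact ⟨g, hg.symm⟩
  · rintro ⟨g, rfl⟩
    simp [comp_distTriang_mor_zero₁₂ T hT]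

variable (k) in
theorem leftComp_exact {T : Triangle 𝒟} (hT : T ∈ distTriang 𝒟) (W : 𝒟) :
    Function.Exact (Linear.leftComp k W T.mor₂) (Linear.leftComp k W T.mor₁) := by
  intro f
  constructor
  · intro hf
    obtain ⟨g, hg⟩ := Triangle.yoneda_exact₂ T hT f hf
    exact ⟨g, hg.symm⟩
  · rintro ⟨g, rfl⟩
    simp [comp_distTriang_mor_zero₁₂_assoc T hT]

/-- Five lemma in the test object: `Hom(X, -)` and the dual of `Hom(-, X')` both turn the triangle
into a long exact sequence. -/
theorem IsSerreForm.of_distinguished {X X' : 𝒟} {t : (X ⟶ X') →ₗ[k] k} {T : Triangle 𝒟}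
    (hT : T ∈ distTriang 𝒟) (h₀ : IsSerreForm t (T.obj₃⟦(-1 : ℤ)⟧)) (h₁ : IsSerreForm t T.obj₁)
    (h₃ : IsSerreForm t T.obj₃) (h₄ : IsSerreForm t (T.obj₁⟦(1 : ℤ)⟧)) :
    IsSerreForm t T.obj₂ := by
  obtain ⟨i, hi, hi'⟩ : ∃ i : T.obj₃⟦(-1 : ℤ)⟧ ⟶ T.obj₁,
      Function.Exact (Linear.rightComp k X i) (Linear.rightComp k X T.mor₁) ∧
      Function.Exact (Linear.leftComp k X' T.mor₁) (Linear.leftComp k X' i) :=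
    ⟨T.invRotate.mor₁, rightComp_exact k (inv_rot_of_distTriang _ hT) X,
      leftComp_exact k (inv_rot_of_distTriang _ hT) X'⟩
  have hR : Function.Exact (Linear.rightComp k X T.mor₂) (Linear.rightComp k X T.mor₃) :=
    rightComp_exact k (rot_of_distTriang _ hT) X
  have hR' : Function.Exact (Linear.leftComp k X' T.mor₃) (Linear.leftComp k X' T.mor₂) :=
    leftComp_exact k (rot_of_distTriang _ hT) X'
  refine ⟨?_, ?_⟩
  · have := h₁.finite
    have := h₃.finite
    exact finite_of_exact (leftComp_exact k hT X')
  · exact LinearMap.bijective_of_surjective_of_bijective_of_bijective_of_injective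
      (Linear.rightComp k X i) (Linear.rightComp k X T.mor₁)
      (Linear.rightComp k X T.mor₂) (Linear.rightComp k X T.mor₃)
      (Linear.leftComp k X' i).dualMap (Linear.leftComp k X' T.mor₁).dualMap
      (Linear.leftComp k X' T.mor₂).dualMap (Linear.leftComp k X' T.mor₃).dualMap
      (serrePairing t _) (serrePairing t _) (serrePairing t _) (serrePairing t _)
      (serrePairing t _)
      (by ext; simp) (by ext; simp) (by ext; simp) (by ext; simp)
      hi (rightComp_exact k hT X) hR
      (exact_dualMap hi') (exact_dualMap (leftComp_exact k hT X'))
      (exact_dualMap hR')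
      h₀.bijective.2 h₁.bijective h₃.bijective h₄.bijective.1

variable [∀ n : ℤ, (shiftFunctor 𝒟 n).Linear k]

/-- Linear forms on the first two vertices of a pair of triangles that are compatible with the
first morphisms induce a compatible linear form on the third vertices. -/
theorem exists_form_cone {T T' : Triangle 𝒟} (hT : T ∈ distTriang 𝒟) (hT' : T' ∈ distTriang 𝒟)
    (t₁ : (T.obj₁ ⟶ T'.obj₁) →ₗ[k] k) (t₂ : (T.obj₂ ⟶ T'.obj₂) →ₗ[k] k)
    (h : ∀ r : T.obj₂ ⟶ T'.obj₁, t₂ (r ≫ T'.mor₁) = t₁ (T.mor₁ ≫ r)) :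
    ∃ t₃ : (T.obj₃ ⟶ T'.obj₃) →ₗ[k] k,
      (∀ u : T.obj₁⟦(1 : ℤ)⟧ ⟶ T'.obj₃, t₃ (T.mor₃ ≫ u) = -shiftForm 1 t₁ (u ≫ T'.mor₃)) ∧
      ∀ v : T.obj₃ ⟶ T'.obj₂, t₃ (v ≫ T'.mor₂) = t₂ (T.mor₂ ≫ v) := by
  obtain ⟨t₃, h₁, h₂⟩ := exists_linear_extension (Linear.leftComp k T'.obj₃ T.mor₃)
    (Linear.rightComp k T.obj₃ T'.mor₂)
    (-(shiftForm 1 t₁ ∘ₗ Linear.rightComp k _ T'.mor₃)) (t₂ ∘ₗ Linear.leftComp k _ T.mor₂) (by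
      intro u v huv
      simp only [Linear.leftComp_apply, Linear.rightComp_apply] at huv
      -- On the overlap, the square formed by `u` and `v` extends to a morphism of rotated
      -- triangles, whose third component `r` transfers the condition to `h`. The signs from
      -- rotation force the minus sign in front of `shiftForm 1 t₁`.
      obtain ⟨s, hs₁, hs₂⟩ := complete_distinguished_triangle_morphism T.rotate.rotate T'.rotate
        (rot_of_distTriang _ (rot_of_distTriang _ hT)) (rot_of_distTriang _ hT') v u huv
      obtain ⟨r, rfl⟩ : ∃ r : T.obj₂ ⟶ T'.obj₁, r⟦(1 : ℤ)⟧' = s :=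
        (shiftFunctor 𝒟 (1 : ℤ)).map_surjective s
      have e₁ : u ≫ T'.mor₃ = -(T.mor₁ ≫ r)⟦(1 : ℤ)⟧' := by
        rw [Functor.map_comp, ← Preadditive.neg_comp]
        exact hs₁.symm
      have e₂ : T.mor₂ ≫ v = r ≫ T'.mor₁ := by
        apply (shiftFunctor 𝒟 (1 : ℤ)).map_injective
        have : -T.mor₂⟦(1 : ℤ)⟧' ≫ v⟦(1 : ℤ)⟧' = r⟦(1 : ℤ)⟧' ≫ (-T'.mor₁⟦(1 : ℤ)⟧') := by
          rw [← Preadditive.neg_comp]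
          exact hs₂
        rw [Functor.map_comp, Functor.map_comp]
        simpa using this
      simp only [LinearMap.neg_apply, LinearMap.comp_apply, Linear.rightComp_apply,
        Linear.leftComp_apply, e₁, e₂, map_neg, neg_neg, shiftForm_map, h])
  exact ⟨t₃, h₁, h₂⟩

/-- Five lemma in the pair of objects, with the test object fixed: the three compatibilities make
the ladder of pairings commute once the two shifted forms are negated. -/
theorem IsSerreForm.cone {T T' : Triangle 𝒟} (hT : T ∈ distTriang 𝒟) (hT' : T' ∈ distTriang 𝒟)
    {t₁ : (T.obj₁ ⟶ T'.obj₁) →ₗ[k] k} {t₂ : (T.obj₂ ⟶ T'.obj₂) →ₗ[k] k}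
    {t₃ : (T.obj₃ ⟶ T'.obj₃) →ₗ[k] k}
    (h : ∀ r : T.obj₂ ⟶ T'.obj₁, t₂ (r ≫ T'.mor₁) = t₁ (T.mor₁ ≫ r))
    (h₁ : ∀ u : T.obj₁⟦(1 : ℤ)⟧ ⟶ T'.obj₃, t₃ (T.mor₃ ≫ u) = -shiftForm 1 t₁ (u ≫ T'.mor₃))
    (h₂ : ∀ v : T.obj₃ ⟶ T'.obj₂, t₃ (v ≫ T'.mor₂) = t₂ (T.mor₂ ≫ v)) {Z : 𝒟}
    (ht₁ : IsSerreForm t₁ Z) (ht₂ : IsSerreForm t₂ Z) (ht₁' : IsSerreForm (shiftForm 1 t₁) Z)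
    (ht₂' : IsSerreForm (shiftForm 1 t₂) Z) : IsSerreForm t₃ Z := by
  have hR : Function.Exact (Linear.leftComp k Z T.mor₃) (Linear.leftComp k Z T.mor₂) :=
    leftComp_exact k (rot_of_distTriang _ hT) Z
  have hR' : Function.Exact (Linear.rightComp k Z T'.mor₂) (Linear.rightComp k Z T'.mor₃) :=
    rightComp_exact k (rot_of_distTriang _ hT') Z
  have hRR : Function.Exact (Linear.leftComp k Z (-T.mor₁⟦(1 : ℤ)⟧'))
      (Linear.leftComp k Z T.mor₃) :=
    leftComp_exact k (rot_of_distTriang _ (rot_of_distTriang _ hT)) Z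
  have hRR' : Function.Exact (Linear.rightComp k Z T'.mor₃)
      (Linear.rightComp k Z (-T'.mor₁⟦(1 : ℤ)⟧')) :=
    rightComp_exact k (rot_of_distTriang _ (rot_of_distTriang _ hT')) Z
  have hn : (-1 : k) ≠ 0 := neg_ne_zero.2 one_ne_zero
  refine ⟨?_, ?_⟩
  · have := ht₁'.finite
    have := ht₂.finite
    exact finite_of_exact hR'
  · have hs : ∀ r : T.obj₂⟦(1 : ℤ)⟧ ⟶ T'.obj₁⟦(1 : ℤ)⟧,
        shiftForm 1 t₂ (r ≫ T'.mor₁⟦1⟧') = shiftForm 1 t₁ (T.mor₁⟦1⟧' ≫ r) := by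
      intro r
      obtain ⟨r, rfl⟩ := (shiftFunctor 𝒟 (1 : ℤ)).map_surjective r
      rw [← Functor.map_comp, ← Functor.map_comp, shiftForm_map, shiftForm_map, h]
    exact LinearMap.bijective_of_surjective_of_bijective_of_bijective_of_injective
      (Linear.leftComp k Z (-T.mor₁⟦(1 : ℤ)⟧')) (Linear.leftComp k Z T.mor₃)
      (Linear.leftComp k Z T.mor₂) (Linear.leftComp k Z T.mor₁)
      (Linear.rightComp k Z (-T'.mor₁⟦(1 : ℤ)⟧')).dualMap (Linear.rightComp k Z T'.mor₃).dualMap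
      (Linear.rightComp k Z T'.mor₂).dualMap (Linear.rightComp k Z T'.mor₁).dualMap
      (serrePairing ((-1 : k) • shiftForm 1 t₂) _) (serrePairing ((-1 : k) • shiftForm 1 t₁) _)
      (serrePairing t₃ _) (serrePairing t₂ _) (serrePairing t₁ _)
      (by ext r s; simpa using hs (r ≫ s)) (by ext; simp [h₁]) (by ext; simp [← h₂])
      (by ext; simp [← h])
      hRR hR (leftComp_exact k hT Z)
      (exact_dualMap hRR') (exact_dualMap hR')
      (exact_dualMap (rightComp_exact k hT' Z))
      (ht₂'.smul hn).bijective.2 (ht₁'.smul hn).bijective ht₂.bijective ht₁.bijective.1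

theorem SerreDualPair.cone {P : ObjectProperty 𝒟} [P.IsStableUnderShift ℤ] {T T' : Triangle 𝒟}
    (hT : T ∈ distTriang 𝒟) (hT' : T' ∈ distTriang 𝒟) (hf : T.mor₁ ≠ 0)
    (hg : ∀ g : T'.obj₁ ⟶ T'.obj₂, ∃ c : k, g = c • T'.mor₁)
    (hP : P T.obj₂) (hP' : P T'.obj₁) (h₁ : SerreDualPair k P T.obj₁ T'.obj₁)
    (h₂ : SerreDualPair k P T.obj₂ T'.obj₂) : SerreDualPair k P T.obj₃ T'.obj₃ := by
  obtain ⟨t₁, ht₁⟩ := h₁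
  obtain ⟨t₂, ht₂⟩ := h₂
  -- `g` is the adjoint of `T.mor₁` for the two forms. It is `c • T'.mor₁`, so replacing `t₂` by `c
  -- • t₂` makes `T'.mor₁` the adjoint; `c ≠ 0` because an adjoint `0` would force `T.mor₁ = 0`.
  obtain ⟨g, hg'⟩ := (ht₂ _ hP').exists_comp_eq (t₁ ∘ₗ Linear.leftComp k _ T.mor₁)
  obtain ⟨c, rfl⟩ := hg g
  simp only [Linear.comp_smul, map_smul, smul_eq_mul, LinearMap.comp_apply,
    Linear.leftComp_apply] at hg'
  have hc : c ≠ 0 := by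
    rintro rfl
    refine hf ((ht₁ _ hP).ext_left fun r => ?_)
    rw [← hg', zero_mul, zero_comp, map_zero]
  have ht₂c : ∀ Z, P Z → IsSerreForm (c • t₂) Z := fun Z hZ => (ht₂ Z hZ).smul hc
  have h : ∀ r : T.obj₂ ⟶ T'.obj₁, (c • t₂) (r ≫ T'.mor₁) = t₁ (T.mor₁ ≫ r) := hg'
  obtain ⟨t₃, h₁, h₂⟩ := exists_form_cone hT hT' t₁ (c • t₂) h
  exact ⟨t₃, fun Z hZ => .cone hT hT' h h₁ h₂ (ht₁ Z hZ) (ht₂c Z hZ)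
    (isSerreForm_shift ht₁ 1 Z hZ) (isSerreForm_shift ht₂c 1 Z hZ)⟩

end Triangulated

section Pairing

theorem IsSerreForm.of_subsingleton {k : Type*} [Field k] {𝒟 : Type*} [Category* 𝒟]
    [Preadditive 𝒟] [Linear k 𝒟] {X X' : 𝒟} (t : (X ⟶ X') →ₗ[k] k) (Z : 𝒟)
    [Subsingleton (X ⟶ Z)] [Subsingleton (Z ⟶ X')] : IsSerreForm t Z := by
  refine ⟨inferInstance, Function.injective_of_subsingleton _, fun φ => ⟨0, ?_⟩⟩
  ext g
  rw [Subsingleton.elim g 0, map_zero, map_zero]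

end Pairing

/-! ### Reduction from the bounded derived category to the abelian category. -/

section Bounded

open Pretriangulated Triangulated DerivedCategory DerivedCategory.TStructure

variable {A : Type*} [Category* A] [Abelian A] [HasDerivedCategory.{w} A]

/-- The bounded derived category is generated under extensions by the complexes concentrated in
one degree. -/
theorem bounded_induction {motive : DerivedCategory A → Prop}
    (iso : ∀ {X Y : DerivedCategory A}, (X ≅ Y) → motive X → motive Y)
    (single : ∀ (n : ℤ) (N : A), motive ((singleFunctor A n).obj N))
    (ext : ∀ T ∈ distTriang (DerivedCategory A), motive T.obj₁ → motive T.obj₃ → motive T.obj₂)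
    (Z : DerivedCategory A) (hZ : (t : TStructure (DerivedCategory A)).bounded Z) : motive Z := by
  have key : ∀ (m : ℕ) (a : ℤ) (Z : DerivedCategory A), t.IsGE Z a → t.IsLE Z (a + m) →
      motive Z := by
    intro m a
    induction m with
    | zero =>
      intro Z _ hZ
      rw [Nat.cast_zero, add_zero] at hZ
      obtain ⟨Y, ⟨e⟩⟩ := exists_iso_singleFunctor_obj_of_isGE_of_isLE Z a
      exact iso e.symm (single a Y)
    | succ m ih =>
      intro Z _ _
      -- Truncation splits off the top degree: `X` has smaller amplitude and `Y` turns out to be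
      -- concentrated in degree `a + m + 1`.
      obtain ⟨X, Y, hX, hY, f, g, h, hT⟩ := t.exists_triangle Z (a + m) (a + (m + 1 : ℕ))
        (by push_cast; ring)
      rw [t.le_iff_isLE] at hX
      rw [t.ge_iff_isGE] at hY
      have hYa : t.IsGE Y a := t.isGE_of_ge Y a (a + (m + 1 : ℕ)) (by omega)
      have := t.isGE_shift Y a (-1) (a + 1)
      have hXa : t.IsGE X a := t.isGE₂ _ (inv_rot_of_distTriang _ hT) a
        (t.isGE_of_ge (Y⟦(-1 : ℤ)⟧) a (a + 1)) ‹_›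
      have := t.isLE_shift X (a + m) 1 (a + m - 1)
      have hY' : t.IsLE Y (a + (m + 1 : ℕ)) := t.isLE₂ _ (rot_of_distTriang _ hT) _ ‹_›
        (t.isLE_of_le (X⟦(1 : ℤ)⟧) (a + m - 1) _)
      refine ext _ hT (ih X hXa hX) ?_
      obtain ⟨Y', ⟨e⟩⟩ := exists_iso_singleFunctor_obj_of_isGE_of_isLE Y (a + (m + 1 : ℕ))
      exact iso e.symm (single _ Y')
  obtain ⟨⟨a, ha⟩, ⟨b, hb⟩⟩ := hZ
  exact key (b - a).toNat a Z ha (t.isLE_of_le Z b _ (by omega))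

variable {k : Type*} [Field k] [Linear k A]

theorem isSerreForm_of_single {X X' : DerivedCategory A} {s : (X ⟶ X') →ₗ[k] k}
    (h : ∀ (n : ℤ) (N : A), IsSerreForm s ((singleFunctor A n).obj N)) (Z : DerivedCategory A)
    (hZ : (t : TStructure (DerivedCategory A)).bounded Z) : IsSerreForm s Z := by
  -- The five lemma also needs shifts of the outer vertices, so the induction carries all shifts at
  -- once.
  suffices ∀ j : ℤ, IsSerreForm s (Z⟦j⟧) from (this 0).of_iso ((shiftFunctorZero _ ℤ).app Z)
  refine bounded_induction (motive := fun Z => ∀ j : ℤ, IsSerreForm s (Z⟦j⟧)) ?_ ?_ ?_ Z hZ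
  · exact fun e hX j => (hX j).of_iso ((shiftFunctor _ j).mapIso e)
  · exact fun n N j => (h (n - j) N).of_iso
      (((singleFunctors A).shiftIso j (n - j) n (by omega)).app N).symm
  · intro T hT h₁ h₃ j
    exact IsSerreForm.of_distinguished (Triangle.shift_distinguished T hT j)
      ((h₃ (j - 1)).of_iso ((shiftFunctorAdd' _ j (-1) (j - 1) (by omega)).app _)) (h₁ j) (h₃ j)
      ((h₁ (j + 1)).of_iso ((shiftFunctorAdd' _ j 1 (j + 1) rfl).app _))

/-- A projective and an injective object that are dual in the abelian category are Serre dual in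
the bounded derived category. -/
theorem serreDualPair_single {P I : A} [Projective P] [Injective I]
    (h : SerreDualPair k (⊤ : ObjectProperty A) P I) :
    SerreDualPair k (t : TStructure (DerivedCategory A)).bounded ((singleFunctor A 0).obj P)
      ((singleFunctor A 0).obj I) := by
  obtain ⟨s, hs⟩ := h
  let e (X Y : A) : (X ⟶ Y) ≃ₗ[k] ((singleFunctor A 0).obj X ⟶ (singleFunctor A 0).obj Y) :=
    LinearEquiv.ofBijective ((singleFunctor A 0).mapLinearMap k)
      ⟨(singleFunctor A 0).map_injective, (singleFunctor A 0).map_surjective⟩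
  refine ⟨s ∘ₗ (e P I).symm.toLinearMap, isSerreForm_of_single fun n N => ?_⟩
  -- Off degree `0` both Hom spaces vanish: one by the t-structure, the other by projectivity of `P`
  -- (`n < 0`) or injectivity of `I` (`n > 0`).
  have hsub {U V : A} {a b : ℤ} (hab : a < b) :
      Subsingleton ((singleFunctor A a).obj U ⟶ (singleFunctor A b).obj V) :=
    subsingleton_of_forall_eq 0 fun f => t.zero f a b hab
  rcases lt_trichotomy n 0 with hn | rfl | hn
  · have : Subsingleton ((singleFunctor A 0).obj P ⟶ (singleFunctor A n).obj N) :=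
      subsingleton_of_forall_eq 0 fun f => from_singleFunctor_obj_eq_zero_of_projective
        (L := (CochainComplex.singleFunctor A n).obj N) f n hn
    have := hsub (U := N) (V := I) hn
    exact .of_subsingleton _ _
  · refine (hs N trivial).congr (e P N) (e N I) fun f g => ?_
    have : e P N f ≫ e N I g = e P I (f ≫ g) := ((singleFunctor A 0).map_comp f g).symm
    rw [this]
    simp
  · have : Subsingleton ((singleFunctor A n).obj N ⟶ (singleFunctor A 0).obj I) :=
      subsingleton_of_forall_eq 0 fun f => to_singleFunctor_obj_eq_zero_of_injective
        (K := (CochainComplex.singleFunctor A n).obj N) f n hn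
    have := hsub (U := P) (V := N) hn
    exact .of_subsingleton _ _

/-- Short exact sequences `0 ⟶ X₁ ⟶ X₂ ⟶ X₃ ⟶ 0` and `0 ⟶ Y₃ ⟶ Y₁ ⟶ Y₂ ⟶ 0` such that the first
two objects of the sequences are Serre dual up to a shift: then so are the third objects. -/
theorem serreDualPair_of_shortExact {S S' : ShortComplex A} (hS : S.ShortExact)
    (hS' : S'.ShortExact) (hf : S.f ≠ 0) (hg : ∀ g : S'.X₂ ⟶ S'.X₃, ∃ c : k, g = c • S'.g) (n : ℤ)
    (h₁ : SerreDualPair k (t : TStructure (DerivedCategory A)).bounded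
      ((singleFunctor A 0).obj S.X₁) (((singleFunctor A 0).obj S'.X₂)⟦n⟧))
    (h₂ : SerreDualPair k (t : TStructure (DerivedCategory A)).bounded
      ((singleFunctor A 0).obj S.X₂) (((singleFunctor A 0).obj S'.X₃)⟦n⟧)) :
    SerreDualPair k (t : TStructure (DerivedCategory A)).bounded
      ((singleFunctor A 0).obj S.X₃) (((singleFunctor A 0).obj S'.X₁)⟦n + 1⟧) := by
  have hb (N : A) : (t : TStructure (DerivedCategory A)).bounded ((singleFunctor A 0).obj N) :=
    ⟨⟨0, inferInstance⟩, ⟨0, inferInstance⟩⟩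
  -- The sign `n.negOnePow` is the one that shifting a triangle puts on its morphisms.
  have hg' : ∀ g : ((singleFunctor A 0).obj S'.X₂)⟦n⟧ ⟶ ((singleFunctor A 0).obj S'.X₃)⟦n⟧,
      ∃ c : k, g = c • n.negOnePow • ((singleFunctor A 0).map S'.g)⟦n⟧' := by
    intro g
    obtain ⟨g, rfl⟩ := (shiftFunctor (DerivedCategory A) n).map_surjective g
    obtain ⟨g, rfl⟩ := (singleFunctor A 0).map_surjective g
    obtain ⟨c, rfl⟩ := hg g
    rcases Int.even_or_odd n with hn | hn
    · exact ⟨c, by simp [Int.negOnePow_even n hn, Functor.map_smul]⟩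
    · exact ⟨-c, by simp [Int.negOnePow_odd n hn, Functor.map_smul]⟩
  have hT := hS.singleTriangle_distinguished
  -- Rotation makes `S'.X₁⟦1⟧` the third vertex, which accounts for the extra shift.
  have hT' := Triangle.shift_distinguished _
    (rot_of_distTriang _ hS'.singleTriangle_distinguished) n
  have key := SerreDualPair.cone (k := k) hT hT' (P := (t : TStructure (DerivedCategory A)).bounded)
    ?_ ?_ (hb _) ?_ h₁ h₂
  · exact key.of_iso (Iso.refl _) ((shiftFunctorAdd' _ 1 n (n + 1) (add_comm _ _)).symm.app _)
  · intro h
    exact hf ((singleFunctor A 0).map_injective (h.trans ((singleFunctor A 0).map_zero _ _).symm))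
  · exact hg'
  · exact (t : TStructure (DerivedCategory A)).bounded.le_shift n _ (hb _)

end Bounded

/-! ### Representations with convex support. -/

section Support

variable {k : Type v} [Field k] {L : Type u}

open Classical in
theorem suppMap_coe (S : Set L) (x y : L) (a : suppValue k S x) :
    (suppMap k S x y a : k) = if y ∈ S then (a : k) else 0 := by
  split_ifs with h
  · exact suppMap_apply_coe k S x y h a
  · exact (mem_suppValue k).1 (suppMap k S x y a).2 h

variable (k) in
open Classical in
/-- The identity of `k` at a point of two supports, and `0` elsewhere. -/
noncomputable def suppRestrict (S T : Set L) (x : L) : suppValue k S x →ₗ[k] suppValue k T x :=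
  ((if x ∈ T then LinearMap.id else 0 : k →ₗ[k] k).comp
    (suppValue k S x).subtype).codRestrict (suppValue k T x) (by
      intro a
      rw [mem_suppValue]
      intro hx
      simp [hx])

open Classical in
theorem suppRestrict_coe (S T : Set L) (x : L) (a : suppValue k S x) :
    (suppRestrict k S T x a : k) = if x ∈ T then (a : k) else 0 := by
  by_cases h : x ∈ T <;> simp [suppRestrict, h]

/-- The element `1` of the value of a representation at a point of its support. -/
def suppOne {S : Set L} {x : L} (hx : x ∈ S) : suppValue k S x :=
  ⟨1, (mem_suppValue k).2 fun h => (h hx).elim⟩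

theorem eq_smul_suppOne {S : Set L} {x : L} (hx : x ∈ S) (a : suppValue k S x) :
    a = (a : k) • suppOne hx := by
  ext
  simp [suppOne]

end Support

section Representations

variable {k : Type v} [Field k] {L : Type u} [Lattice L]

theorem shortExact_of_pointwise {S : ShortComplex (LatticeRep k L)}
    (hf : ∀ x, Function.Injective (S.f.app x).hom.hom)
    (hg : ∀ x, Function.Surjective (S.g.app x).hom.hom)
    (h : ∀ x, Function.Exact (S.f.app x).hom.hom (S.g.app x).hom.hom) : S.ShortExact where
  exact := by
    rw [ShortComplex.exact_iff_isZero_homology, Functor.isZero_iff]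
    intro x
    refine Limits.IsZero.of_iso ?_ (S.mapHomologyIso ((evaluation L (FGModuleCat k)).obj x)).symm
    rw [← ShortComplex.exact_iff_isZero_homology,
      ← ShortComplex.exact_map_iff_of_faithful _ (forget₂ (FGModuleCat k) (ModuleCat k)),
      ShortComplex.ShortExact.moduleCat_exact_iff_function_exact]
    exact h x
  mono_f := by
    have (x : L) : Mono (S.f.app x) :=
      (forget₂ (FGModuleCat k) (ModuleCat k)).mono_of_mono_map
        ((ModuleCat.mono_iff_injective _).2 (hf x))
    exact NatTrans.mono_of_mono_app _
  epi_g := by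
    have (x : L) : Epi (S.g.app x) :=
      (forget₂ (FGModuleCat k) (ModuleCat k)).epi_of_epi_map
        ((ModuleCat.epi_iff_surjective _).2 (hg x))
    exact NatTrans.epi_of_epi_app _

theorem app_surjective_of_epi {M N : LatticeRep k L} (f : M ⟶ N) [Epi f] (x : L) :
    Function.Surjective (f.app x).hom.hom :=
  (ModuleCat.epi_iff_surjective ((forget₂ (FGModuleCat k) (ModuleCat k)).map (f.app x))).1
    inferInstance

theorem app_injective_of_mono {M N : LatticeRep k L} (f : M ⟶ N) [Mono f] (x : L) :
    Function.Injective (f.app x).hom.hom :=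
  (ModuleCat.mono_iff_injective ((forget₂ (FGModuleCat k) (ModuleCat k)).map (f.app x))).1
    inferInstance

theorem app_naturality {M N : LatticeRep k L} (f : M ⟶ N) {x y : L} (i : x ⟶ y) (m : M.obj x) :
    (f.app y).hom.hom ((M.map i).hom.hom m) = (N.map i).hom.hom ((f.app x).hom.hom m) :=
  congr($(f.naturality i).hom.hom m)

theorem rep_hom_ext {M N : LatticeRep k L} {f g : M ⟶ N}
    (h : ∀ x m, (f.app x).hom.hom m = (g.app x).hom.hom m) : f = g := by
  ext x m
  exact h x m

variable (k) in
theorem convexRep_congr {S T : Set L} (h : S = T) (hS : S.OrdConnected) (hT : T.OrdConnected) :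
    convexRep k S hS = convexRep k T hT := by
  subst h
  rfl

variable (k) in
/-- The canonical morphism between the representations with supports `S` and `T`, the identity of
`k` on `S ∩ T`. -/
noncomputable def convexRepHom {S T : Set L} (hS : S.OrdConnected) (hT : T.OrdConnected)
    (h : ∀ x ∈ S, ∀ y ∈ T, x ≤ y → (y ∈ S ↔ x ∈ T)) : convexRep k S hS ⟶ convexRep k T hT where
  app x := FGModuleCat.ofHom (suppRestrict k S T x)
  naturality x y i := by
    ext a
    change suppValue k S x at a
    refine Subtype.ext ?_
    change (suppRestrict k S T y (suppMap k S x y a) : k) =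
      (suppMap k T x y (suppRestrict k S T x a) : k)
    rw [suppRestrict_coe, suppMap_coe, suppMap_coe, suppRestrict_coe]
    by_cases hx : x ∈ S
    · by_cases hy : y ∈ T
      · have := h x hx y hy (leOfHom i)
        by_cases hxT : x ∈ T
        · simp [hxT, this.2 hxT]
        · simp [hxT, mt this.1 hxT]
      · simp [hy]
    · have : (a : k) = 0 := (mem_suppValue k).1 a.2 hx
      simp [this]

variable (k) in
/-- The sequence of representations attached to a decomposition of a convex set into an upper and a
lower part. -/
noncomputable def convexSequence {S S₁ S₂ : Set L} (hS : S.OrdConnected) (hS₁ : S₁.OrdConnected)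
    (hS₂ : S₂.OrdConnected) (h₁ : ∀ x, x ∈ S₁ → x ∈ S) (h₂ : ∀ x, x ∈ S₂ ↔ x ∈ S ∧ x ∉ S₁)
    (hup : ∀ x ∈ S₁, ∀ y ∈ S, x ≤ y → y ∈ S₁) : ShortComplex (LatticeRep k L) where
  X₁ := convexRep k S₁ hS₁
  X₂ := convexRep k S hS
  X₃ := convexRep k S₂ hS₂
  f := convexRepHom k hS₁ hS fun x hx y hy hxy => iff_of_true (hup x hx y hy hxy) (h₁ x hx)
  g := convexRepHom k hS hS₂ fun x hx y hy hxy => iff_of_true ((h₂ y).1 hy).1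
    ((h₂ x).2 ⟨hx, fun h => ((h₂ y).1 hy).2 (hup x h y ((h₂ y).1 hy).1 hxy)⟩)
  zero := by
    ext x a
    change suppValue k S₁ x at a
    refine Subtype.ext ?_
    change (suppRestrict k S S₂ x (suppRestrict k S₁ S x a) : k) = 0
    rw [suppRestrict_coe, suppRestrict_coe]
    by_cases hx : x ∈ S₂
    · have : (a : k) = 0 := (mem_suppValue k).1 a.2 ((h₂ x).1 hx).2
      simp [this]
    · simp [hx]

theorem convexSequence_shortExact {S S₁ S₂ : Set L} (hS : S.OrdConnected)
    (hS₁ : S₁.OrdConnected) (hS₂ : S₂.OrdConnected) (h₁ : ∀ x, x ∈ S₁ → x ∈ S)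
    (h₂ : ∀ x, x ∈ S₂ ↔ x ∈ S ∧ x ∉ S₁) (hup : ∀ x ∈ S₁, ∀ y ∈ S, x ≤ y → y ∈ S₁) :
    (convexSequence k hS hS₁ hS₂ h₁ h₂ hup).ShortExact := by
  refine shortExact_of_pointwise (fun x => ?_) (fun x => ?_) (fun x => ?_)
  · change Function.Injective (suppRestrict k S₁ S x)
    intro a b hab
    ext
    by_cases hx : x ∈ S₁
    · have := congrArg (Subtype.val) hab
      rwa [suppRestrict_coe, suppRestrict_coe, if_pos (h₁ x hx), if_pos (h₁ x hx)] at this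
    · rw [(mem_suppValue k).1 a.2 hx, (mem_suppValue k).1 b.2 hx]
  · change Function.Surjective (suppRestrict k S S₂ x)
    intro a
    refine ⟨⟨a, (mem_suppValue k).2 fun hx => (mem_suppValue k).1 a.2
      fun h => hx ((h₂ x).1 h).1⟩, ?_⟩
    ext
    rw [suppRestrict_coe]
    split_ifs with hx
    · rfl
    · exact ((mem_suppValue k).1 a.2 hx).symm
  · change Function.Exact (suppRestrict k S₁ S x) (suppRestrict k S S₂ x)
    intro a
    constructor
    · intro ha
      refine ⟨⟨a, (mem_suppValue k).2 fun hx => ?_⟩, ?_⟩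
      · by_cases hxS : x ∈ S
        · have := congrArg (Subtype.val) ha
          rwa [suppRestrict_coe, if_pos ((h₂ x).2 ⟨hxS, hx⟩)] at this
        · exact (mem_suppValue k).1 a.2 hxS
      · ext
        rw [suppRestrict_coe]
        split_ifs with hx
        · rfl
        · exact ((mem_suppValue k).1 a.2 hx).symm
    · rintro ⟨b, rfl⟩
      ext
      rw [suppRestrict_coe, suppRestrict_coe]
      by_cases hx : x ∈ S₂
      · have : (b : k) = 0 := (mem_suppValue k).1 b.2 ((h₂ x).1 hx).2
        simp [this]
      · simp [hx]

theorem convexRepHom_ne_zero {S T : Set L} (hS : S.OrdConnected) (hT : T.OrdConnected)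
    (h : ∀ x ∈ S, ∀ y ∈ T, x ≤ y → (y ∈ S ↔ x ∈ T)) {x : L} (hx : x ∈ S) (hx' : x ∈ T) :
    convexRepHom k hS hT h ≠ 0 := by
  intro h0
  have : suppRestrict k S T x (suppOne hx) = 0 := 
    congr((NatTrans.app $h0 x).hom.hom (suppOne hx : suppValue k S x))
  have := congrArg Subtype.val this
  rw [suppRestrict_coe, if_pos hx'] at this
  exact one_ne_zero this

/-- If `T` has a largest element and it lies in `S`, then all morphisms are multiples of the
canonical one. -/
theorem exists_eq_smul_convexRepHom {S T : Set L} (hS : S.OrdConnected) (hT : T.OrdConnected)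
    (h : ∀ x ∈ S, ∀ y ∈ T, x ≤ y → (y ∈ S ↔ x ∈ T)) {β : L} (hβ : β ∈ S) (hβ' : β ∈ T)
    (hT' : ∀ x ∈ T, x ≤ β) (f : convexRep k S hS ⟶ convexRep k T hT) :
    ∃ c : k, f = c • convexRepHom k hS hT h := by
  let fβ : suppValue k S β →ₗ[k] suppValue k T β := (f.app β).hom.hom
  -- For `x ∈ T` the map from `x` to `β` in the target is injective, so naturality along `x ≤ β`
  -- determines `f` from its scalar at `β`.
  refine ⟨(fβ (suppOne hβ) : k), rep_hom_ext fun x m => ?_⟩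
  change suppValue k S x at m
  let fx : suppValue k S x →ₗ[k] suppValue k T x := (f.app x).hom.hom
  change fx m = (fβ (suppOne hβ) : k) • suppRestrict k S T x m
  ext
  by_cases hx : x ∈ T
  · have e : fβ (suppMap k S x β m) = suppMap k T x β (fx m) :=
      app_naturality f (homOfLE (hT' x hx)) m
    have e' := congrArg Subtype.val e
    rw [suppMap_apply_coe k T x β hβ', eq_smul_suppOne hβ (suppMap k S x β m), map_smul,
      suppMap_apply_coe k S x β hβ] at e'
    simp only [Submodule.coe_smul, suppRestrict_coe, if_pos hx, smul_eq_mul] at e' ⊢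
    rw [← e', mul_comm]
  · rw [(mem_suppValue k).1 (fx m).2 hx]
    simp [suppRestrict_coe, hx]

section Sequence

variable {S S₁ S₂ : Set L} (hS : S.OrdConnected) (hS₁ : S₁.OrdConnected) (hS₂ : S₂.OrdConnected)
  (h₁ : ∀ x, x ∈ S₁ → x ∈ S) (h₂ : ∀ x, x ∈ S₂ ↔ x ∈ S ∧ x ∉ S₁)
  (hup : ∀ x ∈ S₁, ∀ y ∈ S, x ≤ y → y ∈ S₁)

theorem convexSequence_f_ne_zero {x : L} (hx : x ∈ S₁) :
    (convexSequence k hS hS₁ hS₂ h₁ h₂ hup).f ≠ 0 :=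
  convexRepHom_ne_zero hS₁ hS
    (fun x hx y hy hxy => iff_of_true (hup x hx y hy hxy) (h₁ x hx)) hx (h₁ x hx)

theorem exists_eq_smul_convexSequence_g {β : L} (hβ : β ∈ S₂) (hS₂' : ∀ x ∈ S₂, x ≤ β)
    (g : convexRep k S hS ⟶ convexRep k S₂ hS₂) :
    ∃ c : k, g = c • (convexSequence k hS hS₁ hS₂ h₁ h₂ hup).g :=
  exists_eq_smul_convexRepHom hS hS₂ (fun x hx y hy hxy => iff_of_true ((h₂ y).1 hy).1
    ((h₂ x).2 ⟨hx, fun h => ((h₂ y).1 hy).2 (hup x h y ((h₂ y).1 hy).1 hxy)⟩))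
    ((h₂ β).1 hβ).1 hβ hS₂' g

end Sequence

/-! ### Principal filters and ideals: projectives, injectives and their duality. -/

section Principal

variable {α : L} {S : Set L} (hS : S.OrdConnected)

/-- Evaluation at a point `α` of the support, for a morphism from `convexRep k S hS`. -/
noncomputable def evalFrom (hα : α ∈ S) (N : LatticeRep k L) :
    (convexRep k S hS ⟶ N) →ₗ[k] N.obj α where
  toFun f := (f.app α).hom.hom (suppOne hα : suppValue k S α)
  map_add' _ _ := rfl
  map_smul' _ _ := rfl

/-- Evaluation at `α`, for a morphism to `convexRep k S hS`. -/
noncomputable def evalTo (α : L) (N : LatticeRep k L) :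
    (N ⟶ convexRep k S hS) →ₗ[k] Module.Dual k (N.obj α) where
  toFun g := (suppValue k S α).subtype ∘ₗ (g.app α).hom.hom
  map_add' _ _ := rfl
  map_smul' _ _ := rfl

theorem map_map_apply (N : LatticeRep k L) {x y z : L} (hxy : x ≤ y) (hyz : y ≤ z)
    (n : N.obj x) : (N.map (homOfLE hyz)).hom.hom ((N.map (homOfLE hxy)).hom.hom n) =
      (N.map (homOfLE (hxy.trans hyz))).hom.hom n :=
  congr($((N.map_comp (homOfLE hxy) (homOfLE hyz)).symm).hom.hom n)

theorem map_refl_apply (N : LatticeRep k L) {x : L} (n : N.obj x) :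
    (N.map (homOfLE (le_refl x))).hom.hom n = n :=
  congr($(N.map_id x).hom.hom n)

/-- Yoneda: the representation is generated freely by `1` at `α`. -/
theorem evalFrom_bijective (h : ∀ y, y ∈ S ↔ α ≤ y) (N : LatticeRep k L) :
    Function.Bijective (evalFrom hS ((h α).2 le_rfl) N) := by
  classical
  constructor
  · intro f g hfg
    refine rep_hom_ext fun x m => ?_
    change suppValue k S x at m
    by_cases hx : x ∈ S
    · have key : m = suppMap k S α x ((m : k) • suppOne ((h α).2 le_rfl)) := by
        ext
        rw [suppMap_apply_coe k S α x hx]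
        simp [suppOne]
      have hfg' : (f.app α).hom.hom ((m : k) • (suppOne ((h α).2 le_rfl) : suppValue k S α) :
          suppValue k S α) = (g.app α).hom.hom
          ((m : k) • (suppOne ((h α).2 le_rfl) : suppValue k S α) : suppValue k S α) :=
        ((f.app α).hom.hom.map_smul _ _).trans
          ((congrArg ((m : k) • ·) hfg).trans ((g.app α).hom.hom.map_smul _ _).symm)
      rw [key]
      exact (app_naturality f (homOfLE ((h x).1 hx)) _).trans
        ((congrArg _ hfg').trans (app_naturality g (homOfLE ((h x).1 hx)) _).symm)
    · have : m = 0 := Subtype.ext ((mem_suppValue k).1 m.2 hx)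
      rw [this]
      exact (map_zero (f.app x).hom.hom).trans (map_zero (g.app x).hom.hom).symm
  · intro n
    let φ (y : L) : suppValue k S y →ₗ[k] N.obj y := if hy : α ≤ y then
      (LinearMap.toSpanSingleton k (N.obj y) ((N.map (homOfLE hy)).hom.hom n)).comp
        (suppValue k S y).subtype else 0
    have hφ (y : L) (hy : α ≤ y) (a : suppValue k S y) :
        φ y a = (a : k) • (N.map (homOfLE hy)).hom.hom n := by
      simp [φ, hy]
    refine ⟨⟨fun y => FGModuleCat.ofHom (φ y), fun x y i => ?_⟩, ?_⟩
    · ext a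
      change suppValue k S x at a
      change φ y (suppMap k S x y a) = (N.map i).hom.hom (φ x a)
      by_cases hx : α ≤ x
      · rw [hφ x hx, hφ y (hx.trans (leOfHom i)), suppMap_apply_coe k S x y
          ((h y).2 (hx.trans (leOfHom i))), map_smul]
        exact congrArg _ (map_map_apply N hx (leOfHom i) n).symm
      · have : a = 0 := Subtype.ext ((mem_suppValue k).1 a.2 fun hx' => hx ((h x).1 hx'))
        rw [this, map_zero, map_zero, map_zero, map_zero]
    · change φ α (suppOne _) = n
      rw [hφ α le_rfl, map_refl_apply]
      exact one_smul k n

theorem evalTo_bijective (h : ∀ y, y ∈ S ↔ y ≤ α) (N : LatticeRep k L) :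
    Function.Bijective (evalTo hS α N) := by
  classical
  have hα : α ∈ S := (h α).2 le_rfl
  constructor
  · intro f g hfg
    refine rep_hom_ext fun x m => ?_
    let fx : N.obj x →ₗ[k] suppValue k S x := (f.app x).hom.hom
    let gx : N.obj x →ₗ[k] suppValue k S x := (g.app x).hom.hom
    change fx m = gx m
    ext
    by_cases hx : x ∈ S
    · rw [← suppMap_apply_coe k S x α hα (fx m), ← suppMap_apply_coe k S x α hα (gx m)]
      exact (congrArg Subtype.val (app_naturality f (homOfLE ((h x).1 hx)) m)).symm.trans
        ((LinearMap.congr_fun hfg _).trans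
          (congrArg Subtype.val (app_naturality g (homOfLE ((h x).1 hx)) m)))
    · rw [(mem_suppValue k).1 (fx m).2 hx, (mem_suppValue k).1 (gx m).2 hx]
  · intro ψ
    let φ (y : L) : N.obj y →ₗ[k] suppValue k S y := if hy : y ≤ α then
      (ψ ∘ₗ (N.map (homOfLE hy)).hom.hom).codRestrict (suppValue k S y) fun _ =>
        (mem_suppValue k).2 fun hy' => (hy' ((h y).2 hy)).elim else 0
    have hφ (y : L) (hy : y ≤ α) (a : N.obj y) :
        (φ y a : k) = ψ ((N.map (homOfLE hy)).hom.hom a) := by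
      simp [φ, hy]
    refine ⟨⟨fun y => FGModuleCat.ofHom (φ y), fun x y i => ?_⟩, ?_⟩
    · ext a
      change φ y ((N.map i).hom.hom a) = suppMap k S x y (φ x a)
      ext
      by_cases hy : y ≤ α
      · rw [hφ y hy, suppMap_apply_coe k S x y ((h y).2 hy), hφ x ((leOfHom i).trans hy)]
        exact congrArg ψ (map_map_apply N (leOfHom i) hy a)
      · have hy' : y ∉ S := fun hy' => hy ((h y).1 hy')
        rw [(mem_suppValue k).1 (φ y _).2 hy', (mem_suppValue k).1 (suppMap k S x y _).2 hy']
    · ext a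
      change (φ α a : k) = ψ a
      rw [hφ α le_rfl, map_refl_apply]

theorem projective_convexRep (h : ∀ y, y ∈ S ↔ α ≤ y) : Projective (convexRep k S hS) where
  factors {E N} f e _ := by
    obtain ⟨m, hm⟩ := app_surjective_of_epi e α (evalFrom hS ((h α).2 le_rfl) N f)
    obtain ⟨g, rfl⟩ := (evalFrom_bijective hS h E).2 m
    exact ⟨g, (evalFrom_bijective hS h N).1 hm⟩

theorem injective_convexRep (h : ∀ y, y ∈ S ↔ y ≤ α) : Injective (convexRep k S hS) where
  factors {N E} f e _ := by
    obtain ⟨ψ, hψ⟩ := LinearMap.dualMap_surjective_of_injective (app_injective_of_mono e α)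
      (evalTo hS α N f)
    obtain ⟨g, rfl⟩ := (evalTo_bijective hS h E).2 ψ
    exact ⟨g, (evalTo_bijective hS h N).1 hψ⟩

/-- The two Hom spaces are `N.obj α` and its dual, and the pairing becomes evaluation, which is
perfect because `N.obj α` is finite dimensional. -/
theorem serreDualPair_principal {T : Set L} (hT : T.OrdConnected) (h : ∀ y, y ∈ S ↔ α ≤ y)
    (h' : ∀ y, y ∈ T ↔ y ≤ α) :
    SerreDualPair k (⊤ : ObjectProperty (LatticeRep k L)) (convexRep k S hS)
      (convexRep k T hT) := by
  refine ⟨(Module.Dual.eval k _ (suppOne ((h α).2 le_rfl) : suppValue k S α)) ∘ₗ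
    evalTo hT α (convexRep k S hS), fun N _ => ?_⟩
  let eI := LinearEquiv.ofBijective _ (evalTo_bijective (k := k) hT h' N)
  refine ⟨Module.Finite.equiv eI.symm, ?_⟩
  exact eI.dualMap.bijective.comp ((Module.evalEquiv k (N.obj α)).bijective.comp
    (evalFrom_bijective (k := k) hS h N))

end Principal

end Representations

/-! ### Boolean antichains and the induction over cells. -/

section Boolean

variable {L : Type u} [Lattice L] [DecidableEq L] {C : Finset L} {α : L}

namespace IsBoolean

theorem joinOver_le_iff (hC : IsBoolean C α) {A B : Finset L} (hA : A ⊆ C) (hB : B ⊆ C) :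
    joinOver α A ≤ joinOver α B ↔ A ⊆ B := by
  rw [← sup_eq_right, ← hC.map_sup A hA B hB, ← Finset.union_eq_right]
  exact ⟨hC.injOn _ (Finset.union_subset hA hB) _ hB, congrArg _⟩

theorem coatomsOf_eq (C : Finset L) (α : L) :
    coatomsOf C α = C.image fun c => joinOver α (C.erase c) := by
  ext d
  simp only [coatomsOf, Finset.mem_image, Finset.mem_filter, Finset.mem_powerset]
  constructor
  · rintro ⟨A, ⟨hA, hcard⟩, rfl⟩
    obtain ⟨c, hc⟩ := Finset.card_eq_one.1
      (show (C \ A).card = 1 by rw [Finset.card_sdiff_of_subset hA]; omega)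
    have hcC : c ∈ C \ A := hc ▸ Finset.mem_singleton_self c
    refine ⟨c, (Finset.mem_sdiff.1 hcC).1, ?_⟩
    rw [Finset.erase_eq, ← hc, Finset.sdiff_sdiff_eq_self hA]
  · rintro ⟨c, hc, rfl⟩
    exact ⟨C.erase c, ⟨Finset.erase_subset _ _, Finset.card_erase_add_one hc⟩, rfl⟩

theorem joinOver_erase_injOn (hC : IsBoolean C α) :
    Set.InjOn (fun c => joinOver α (C.erase c)) (C : Set L) := by
  intro c hc d hd h
  have := hC.injOn _ (Finset.erase_subset _ _) _ (Finset.erase_subset _ _) h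
  by_contra hcd
  exact Finset.notMem_erase d C (this ▸ Finset.mem_erase.2 ⟨Ne.symm hcd, hd⟩)

theorem meetUnder_insert {d β : L} (hd : d ≤ β) (A : Finset L) :
    meetUnder β (insert d A) = d ⊓ meetUnder β A := by
  by_cases hA : A.Nonempty
  · simp [meetUnder, hA, Finset.inf'_insert]
  · rw [Finset.not_nonempty_iff_eq_empty] at hA
    simp [meetUnder, hA, hd]

/-- Meets of joins are joins of intersections, and removing the elements of `B` one at a time leaves
`C \ B`. Every axiom of `IsDualBoolean` beyond the antichain conditions follows by complementation.
-/
theorem meetUnder_image (hC : IsBoolean C α) {B : Finset L} (hB : B ⊆ C) :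
    meetUnder (topOf C α) (B.image fun c => joinOver α (C.erase c)) = joinOver α (C \ B) := by
  induction B using Finset.induction_on with
  | empty => simp [meetUnder, topOf]
  | insert c B _ ih =>
    rw [Finset.image_insert, meetUnder_insert (show joinOver α (C.erase c) ≤ topOf C α from
        (hC.joinOver_le_iff (Finset.erase_subset _ _) subset_rfl).2 (Finset.erase_subset _ _)),
      ih ((Finset.subset_insert _ _).trans hB),
      ← hC.map_inf _ (Finset.erase_subset _ _) _ Finset.sdiff_subset]
    congr 1
    ext x
    simp only [Finset.mem_inter, Finset.mem_erase, Finset.mem_sdiff, Finset.mem_insert]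
    tauto

theorem isDualBoolean (hC : IsBoolean C α) : IsDualBoolean (coatomsOf C α) (topOf C α) := by
  have key : ∀ A ⊆ coatomsOf C α, ∃ B ⊆ C, B.image (fun c => joinOver α (C.erase c)) = A := by
    intro A hA
    rw [coatomsOf_eq] at hA
    obtain ⟨B, hB, rfl⟩ := Finset.subset_image_iff.1 hA
    exact ⟨B, by exact_mod_cast hB, rfl⟩
  refine ⟨⟨?_, ?_⟩, ?_, ?_, ?_⟩
  · intro d hd d' hd' hne hle
    rw [coatomsOf_eq, Finset.mem_coe, Finset.mem_image] at hd hd'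
    obtain ⟨c, hc, rfl⟩ := hd
    obtain ⟨c', hc', rfl⟩ := hd'
    have hsub := (hC.joinOver_le_iff (Finset.erase_subset _ _) (Finset.erase_subset _ _)).1 hle
    have hcc : c' ≠ c := by
      rintro rfl
      exact hne rfl
    exact Finset.notMem_erase c' C (hsub (Finset.mem_erase.2 ⟨hcc, hc'⟩))
  · intro d hd
    rw [coatomsOf_eq, Finset.mem_image] at hd
    obtain ⟨c, hc, rfl⟩ := hd
    rw [topOf, lt_iff_le_not_ge, hC.joinOver_le_iff (Finset.erase_subset _ _) subset_rfl,
      hC.joinOver_le_iff subset_rfl (Finset.erase_subset _ _)]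
    exact ⟨Finset.erase_subset _ _, fun h => Finset.notMem_erase c C (h hc)⟩
  · intro A hA A' hA' h
    obtain ⟨B, hB, rfl⟩ := key A hA
    obtain ⟨B', hB', rfl⟩ := key A' hA'
    rw [hC.meetUnder_image hB, hC.meetUnder_image hB'] at h
    have := hC.injOn _ Finset.sdiff_subset _ Finset.sdiff_subset h
    rw [← Finset.sdiff_sdiff_eq_self hB, this, Finset.sdiff_sdiff_eq_self hB']
  · intro A hA A' hA'
    obtain ⟨B, hB, rfl⟩ := key A hA
    obtain ⟨B', hB', rfl⟩ := key A' hA'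
    rw [← Finset.image_union, hC.meetUnder_image hB, hC.meetUnder_image hB',
      hC.meetUnder_image (Finset.union_subset hB hB'),
      ← hC.map_inf _ Finset.sdiff_subset _ Finset.sdiff_subset, Finset.sdiff_union_distrib]
  · intro A hA A' hA'
    obtain ⟨B, hB, rfl⟩ := key A hA
    obtain ⟨B', hB', rfl⟩ := key A' hA'
    rw [← Finset.image_inter_of_injOn _ _ (hC.joinOver_erase_injOn.mono
        (Set.union_subset (by exact_mod_cast hB) (by exact_mod_cast hB'))),
      hC.meetUnder_image hB, hC.meetUnder_image hB',
      hC.meetUnder_image (Finset.inter_subset_left.trans hB),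
      ← hC.map_sup _ Finset.sdiff_subset _ Finset.sdiff_subset, Finset.sdiff_inter_distrib_right]

end IsBoolean

/-- The elements above the join of `A` but not above the join of `A` and any element of `B`. -/
def upperCell (α : L) (A B : Finset L) : Set L :=
  {y | joinOver α A ≤ y ∧ ∀ b ∈ B, ¬ joinOver α (insert b A) ≤ y}

/-- The elements below the join of `U` but not below the join of `U` minus any element of `B`. -/
def lowerCell (α : L) (U B : Finset L) : Set L :=
  {y | y ≤ joinOver α U ∧ ∀ b ∈ B, ¬ y ≤ joinOver α (U.erase b)}

theorem upperCell_ordConnected (α : L) (A B : Finset L) : (upperCell α A B).OrdConnected :=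
  ⟨fun _ hx _ hz _ hy => ⟨hx.1.trans hy.1, fun b hb h => hz.2 b hb (h.trans hy.2)⟩⟩

theorem lowerCell_ordConnected (α : L) (U B : Finset L) : (lowerCell α U B).OrdConnected :=
  ⟨fun _ hx _ hz _ hy => ⟨hy.2.trans hz.1, fun b hb h => hx.2 b hb (hy.1.trans h)⟩⟩

theorem upperCell_singletons (C : Finset L) (α : L) : upperCell α ∅ C = antichainSupport C α := by
  simp [upperCell, antichainSupport, joinOver]

theorem lowerCell_self (C : Finset L) (α : L) :
    lowerCell α C C = dualAntichainSupport (coatomsOf C α) (topOf C α) := by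
  simp [lowerCell, dualAntichainSupport, topOf, IsBoolean.coatomsOf_eq]

namespace IsBoolean

theorem joinOver_insert_insert (hC : IsBoolean C α) {A : Finset L} {b c : L} (hA : A ⊆ C)
    (hb : b ∈ C) (hc : c ∈ C) : joinOver α (insert c (insert b A)) =
      joinOver α (insert c A) ⊔ joinOver α (insert b A) := by
  rw [← hC.map_sup _ (Finset.insert_subset hc hA) _ (Finset.insert_subset hb hA)]
  congr 1
  ext x
  simp only [Finset.mem_union, Finset.mem_insert]
  tauto

theorem mem_upperCell_of_insert (hC : IsBoolean C α) {A B : Finset L} {b : L} (hA : A ⊆ C)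
    (hb : b ∈ C) (hB : B ⊆ C) {x : L} (hx : x ∈ upperCell α (insert b A) B) :
    x ∈ upperCell α A B := by
  refine ⟨((hC.joinOver_le_iff hA (Finset.insert_subset hb hA)).2
    (Finset.subset_insert _ _)).trans hx.1, fun c hc h => hx.2 c hc ?_⟩
  rw [hC.joinOver_insert_insert hA hb (hB hc)]
  exact sup_le h hx.1

theorem mem_upperCell_insert_of_le (hC : IsBoolean C α) {A B : Finset L} {b : L} (hA : A ⊆ C)
    (hb : b ∈ C) (hB : B ⊆ C) {x : L} (hx : x ∈ upperCell α A B)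
    (hbx : joinOver α (insert b A) ≤ x) : x ∈ upperCell α (insert b A) B := by
  refine ⟨hbx, fun c hc h => hx.2 c hc (le_trans ?_ h)⟩
  rw [hC.joinOver_insert_insert hA hb (hB hc)]
  exact le_sup_left

/-- This decomposes the upper cell in the induction step; the join of `A` with `b` and `c` is the
join of the two one-element extensions. -/
theorem mem_upperCell_insert_iff (hC : IsBoolean C α) {A B : Finset L} {b : L} (hA : A ⊆ C)
    (hb : b ∈ C) (hB : B ⊆ C) (x : L) : x ∈ upperCell α A (insert b B) ↔
      x ∈ upperCell α A B ∧ x ∉ upperCell α (insert b A) B := by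
  constructor
  · intro hx
    exact ⟨⟨hx.1, fun c hc => hx.2 c (Finset.mem_insert_of_mem hc)⟩,
      fun h => hx.2 b (Finset.mem_insert_self _ _) h.1⟩
  · rintro ⟨hx, hx'⟩
    refine ⟨hx.1, fun c hc => ?_⟩
    rcases Finset.mem_insert.1 hc with rfl | hc
    · exact fun h => hx' (hC.mem_upperCell_insert_of_le hA hb hB hx h)
    · exact hx.2 c hc

/-- The counterpart for lower cells. Preservation of meets is essential: lying below the joins of
`U` without `b` and of `U` without `c` means lying below the join of `U` without both. -/
theorem mem_lowerCell_erase_iff (hC : IsBoolean C α) {U B : Finset L} {b : L} (hU : U ⊆ C)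
    (x : L) : x ∈ lowerCell α (U.erase b) B ↔
      x ∈ lowerCell α U B ∧ x ∉ lowerCell α U (insert b B) := by
  have hsub (c : L) : U.erase c ⊆ C := (Finset.erase_subset _ _).trans hU
  have hinf (c : L) : joinOver α ((U.erase b).erase c) =
      joinOver α (U.erase b) ⊓ joinOver α (U.erase c) := by
    rw [← hC.map_inf _ (hsub b) _ (hsub c)]
    congr 1
    ext x
    simp only [Finset.mem_inter, Finset.mem_erase]
    tauto
  constructor
  · intro hx
    refine ⟨⟨hx.1.trans ((hC.joinOver_le_iff (hsub b) hU).2 (Finset.erase_subset _ _)),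
      fun c hc h => hx.2 c hc ?_⟩, fun h => h.2 b (Finset.mem_insert_self _ _) hx.1⟩
    rw [hinf]
    exact le_inf hx.1 h
  · rintro ⟨hx, hx'⟩
    refine ⟨?_, fun c hc h => hx.2 c hc (h.trans (by rw [hinf]; exact inf_le_right))⟩
    by_contra h
    refine hx' ⟨hx.1, fun c hc => ?_⟩
    rcases Finset.mem_insert.1 hc with rfl | hc
    · exact h
    · exact hx.2 c hc

end IsBoolean

open DerivedCategory DerivedCategory.TStructure

variable {k : Type v} [Field k] [HasDerivedCategory.{w} (LatticeRep k L)]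

theorem serreDualPair_cells (hC : IsBoolean C α) (B : Finset L) : ∀ A U : Finset L, U ⊆ C →
    B ⊆ U → A = U \ B →
    SerreDualPair k (t : Triangulated.TStructure (DerivedCategory (LatticeRep k L))).bounded
      ((singleFunctor _ 0).obj (convexRep k (upperCell α A B) (upperCell_ordConnected α A B)))
      (((singleFunctor _ 0).obj
        (convexRep k (lowerCell α U B) (lowerCell_ordConnected α U B)))⟦(B.card : ℤ)⟧) := by
  induction B using Finset.induction_on with
  | empty =>
    rintro A U - - rfl
    have h (y : L) : y ∈ upperCell α (U \ ∅) ∅ ↔ joinOver α U ≤ y := by simp [upperCell]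
    have h' (y : L) : y ∈ lowerCell α U ∅ ↔ y ≤ joinOver α U := by simp [lowerCell]
    have := projective_convexRep (k := k) (upperCell_ordConnected α (U \ ∅) ∅) h
    have := injective_convexRep (k := k) (lowerCell_ordConnected α U ∅) h'
    exact (serreDualPair_single (serreDualPair_principal _ _ h h')).of_iso (Iso.refl _)
      ((shiftFunctorZero _ ℤ).symm.app _)
  | insert b B hb ih =>
    rintro A U hU hBU rfl
    have hbU : b ∈ U := hBU (Finset.mem_insert_self _ _)
    have hBU' : B ⊆ U := (Finset.subset_insert _ _).trans hBU
    have hBC : B ⊆ C := hBU'.trans hU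
    have hA : U \ insert b B ⊆ C := Finset.sdiff_subset.trans hU
    have hAC : insert b (U \ insert b B) ⊆ C := Finset.insert_subset (hU hbU) hA
    have hUb : U.erase b ⊆ C := (Finset.erase_subset _ _).trans hU
    have hup : ∀ x ∈ upperCell α (insert b (U \ insert b B)) B,
        ∀ y ∈ upperCell α (U \ insert b B) B, x ≤ y →
        y ∈ upperCell α (insert b (U \ insert b B)) B := fun x hx y hy hxy =>
      hC.mem_upperCell_insert_of_le hA (hU hbU) hBC hy (hx.1.trans hxy)
    have hlow : ∀ x, x ∈ lowerCell α U (insert b B) → x ∈ lowerCell α U B := fun x hx =>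
      ⟨hx.1, fun c hc => hx.2 c (Finset.mem_insert_of_mem hc)⟩
    have hlow' : ∀ x ∈ lowerCell α U (insert b B), ∀ y ∈ lowerCell α U B, x ≤ y →
        y ∈ lowerCell α U (insert b B) := by
      intro x hx y hy hxy
      refine ⟨hy.1, fun c hc => ?_⟩
      rcases Finset.mem_insert.1 hc with rfl | hc
      · exact fun h => hx.2 c (Finset.mem_insert_self _ _) (hxy.trans h)
      · exact hy.2 c hc
    have hS := convexSequence_shortExact (k := k) (upperCell_ordConnected α _ _)
      (upperCell_ordConnected α _ _) (upperCell_ordConnected α _ _)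
      (fun _ => hC.mem_upperCell_of_insert hA (hU hbU) hBC)
      (hC.mem_upperCell_insert_iff hA (hU hbU) hBC) hup
    have hS' := convexSequence_shortExact (k := k) (lowerCell_ordConnected α _ _)
      (lowerCell_ordConnected α _ _) (lowerCell_ordConnected α _ _) hlow
      (hC.mem_lowerCell_erase_iff hU) hlow'
    -- The least element of the smaller upper cell shows that the inclusion is nonzero; the greatest
    -- element of the quotient lower cell, in `hm'`, makes the maps onto it unique up to scalar.
    have hm : joinOver α (insert b (U \ insert b B)) ∈
        upperCell α (insert b (U \ insert b B)) B := by
      refine ⟨le_rfl, fun c hc h => ?_⟩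
      rw [hC.joinOver_le_iff (Finset.insert_subset (hBC hc) hAC) hAC] at h
      have := h (Finset.mem_insert_self _ _)
      simp only [Finset.mem_insert, Finset.mem_sdiff, hc, or_true, not_true, and_false,
        or_false] at this
      exact hb (this ▸ hc)
    have hm' : joinOver α (U.erase b) ∈ lowerCell α (U.erase b) B := by
      refine ⟨le_rfl, fun c hc h => ?_⟩
      rw [hC.joinOver_le_iff hUb ((Finset.erase_subset _ _).trans hUb)] at h
      refine Finset.notMem_erase c _ (h (Finset.mem_erase.2 ⟨?_, hBU' hc⟩))
      rintro rfl
      exact hb hc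
    -- The induction hypothesis is used twice, for `U` and for `U.erase b`, which is why `U` is
    -- quantified inside the induction.
    have key := serreDualPair_of_shortExact (k := k) hS hS'
      (convexSequence_f_ne_zero _ _ _ _ _ _ hm)
      (exists_eq_smul_convexSequence_g _ _ _ _ _ _ hm' fun x hx => hx.1) B.card
      (ih _ U hU hBU' (by
        ext x
        simp only [Finset.mem_insert, Finset.mem_sdiff]
        by_cases hx : x = b
        · simp [hx, hb, hbU]
        · simp [hx]))
      (ih _ (U.erase b) hUb (fun c hc => Finset.mem_erase.2 ⟨fun h => hb (h ▸ hc), hBU' hc⟩) (by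
        ext x
        simp only [Finset.mem_insert, Finset.mem_sdiff, Finset.mem_erase]
        tauto))
    rw [Finset.card_insert_of_notMem hb, Nat.cast_add, Nat.cast_one]
    exact key

theorem IsBoolean.serreDualPair (hC : IsBoolean C α) :
    SerreDualPair k (⊤ : ObjectProperty (DerivedCategory.Bounded (LatticeRep k L)))
      (stalk (antichainModule k C α))
      ((stalk (dualAntichainModule k (coatomsOf C α) (topOf C α)))⟦(C.card : ℤ)⟧) := by
  have h := serreDualPair_cells (k := k) hC C ∅ C subset_rfl subset_rfl (by simp)
  rw [convexRep_congr k (upperCell_singletons C α) _ (antichainSupport_ordConnected C α),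
    convexRep_congr k (lowerCell_self C α) _ (dualAntichainSupport_ordConnected _ _)] at h
  exact SerreDualPair.fullSubcategory (h.of_iso (Iso.refl _)
    ((t.bounded.ι.commShiftIso (C.card : ℤ)).symm.app (stalk _)))

end Boolean

end AntichainSerre

theorem mainTheorem11 {k : Type v} [Field k] {L : Type u} [Lattice L] [Finite L] [DecidableEq L]
    [HasDerivedCategory.{w} (LatticeRep k L)]
    (C : Finset L) (α : L) (hC : IsBoolean C α) :
    IsDualBoolean (coatomsOf C α) (topOf C α) ∧
    IsSerreDual k (stalk (antichainModule k C α))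
      ((stalk (dualAntichainModule k (coatomsOf C α) (topOf C α)))⟦(C.card : ℤ)⟧) ∧
    ∀ S : SerreFunctor k (DerivedCategory.Bounded (LatticeRep k L)),
      Nonempty (S.functor.obj (stalk (antichainModule k C α)) ≅
        (stalk (dualAntichainModule k (coatomsOf C α) (topOf C α)))⟦(C.card : ℤ)⟧) :=
  ⟨hC.isDualBoolean, hC.serreDualPair.isSerreDual, hC.serreDualPair.serreFunctor_iso⟩
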